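/- Let $n\ge 2$, let $\mathbb S^{n-1}\subset\mathbb R^n$ be the unit sphere with the round metric and its Riemannian distance $d(x,y)=\arccos(x\cdot y)$, and let $c(x,y)=\tfrac12 d(x,y)^2$. For $\psi:\mathbb S^{n-1}\to\mathbb R$ put $\psi^c(x)=\sup_{y}\{-c(x,y)-\psi(y)\}$. A function $\phi:\mathbb S^{n-1}\to\mathbb R$ is called c-convex if $\phi=\psi^c$ for some $\psi:\mathbb S^{n-1}\to\mathbb R$ for which these suprema are finite. For such $\phi$ and $x\in\mathbb S^{n-1}$ let $$G_\phi(x)=\{y\in\mathbb S^{n-1}:\ \phi(x)+\phi^c(y)=-c(x,y)\}.$$ For $f:\mathbb S^{n-1}\to\mathbb R$ let $$\partial f(x)=\{p\in T_x\mathbb S^{n-1}:\ f(y)\ge f(x)+p\cdot\exp_x^{-1}(y)+o(d(x,y))\ \text{ as } y\to x\}.$$ Let $\hat x=-x$. For $y\ne\hat x$, $-\nabla_xc(x,y)$ is the usual gradient at $x$ of $-c(\cdot,y)$; for $y=\hat x$, where $-c(\cdot,y)$ is not differentiable at $x$, $-\nabla_xc(x,y)$ stands for every element of the subdifferential $\partial(-c(\cdot,y))(x)$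 (for $y\neq\hat x$ this subdifferential consists of the gradient only). A set $\omega\subset\mathbb S^{n-1}$ is c-convex with respect to $x$ if $\{-\nabla_xc(x,y):y\in\omega\}$ is a convex subset of $T_x\mathbb S^{n-1}$, and $\partial^c\phi(x)=\{-\nabla_xc(x,y):y\in G_\phi(x)\}$. Theorem. Let $\phi$ be c-convex on $\mathbb S^{n-1}$ and $x\in\mathbb S^{n-1}$. Then 1. $G_\phi(x)$ is c-convex with respect to $x$, and $\partial\phi(x)=\partial^c\phi(x)$. 2. If $\hat x\in G_\phi(x)$, then $G_\phi(x)=\mathbb S^{n-1}$. -/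

import Mathlib

open Filter Topology

noncomputable section

namespace SphereOT

/-- The unit sphere `S^{n-1}` of `ℝ^n`. -/
abbrev Sph (n : ℕ) : Type := Metric.sphere (0 : EuclideanSpace ℝ (Fin n)) 1

/-- The tangent space `T_x S^{n-1}`, the hyperplane orthogonal to `x`, with the round metric (the
inner product induced by `ℝ^n`). -/
abbrev Tan {n : ℕ} (x : Sph n) : Submodule ℝ (EuclideanSpace ℝ (Fin n)) :=
  (Submodule.span ℝ {(x : EuclideanSpace ℝ (Fin n))})ᗮ

/-- The Riemannian (great circle) distance `d(x, y) = arccos (x · y)` of the round sphere. -/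
def sdist {n : ℕ} (x y : Sph n) : ℝ :=
  Real.arccos (inner ℝ (x : EuclideanSpace ℝ (Fin n)) (y : EuclideanSpace ℝ (Fin n)))

/-- The quadratic cost `c(x, y) = d(x, y)² / 2`. -/
def cost {n : ℕ} (x y : Sph n) : ℝ := sdist x y ^ 2 / 2

theorem exp_mem {n : ℕ} (x : Sph n) (v : Tan x) :
    Real.cos ‖v‖ • (x : EuclideanSpace ℝ (Fin n)) +
      Real.sinc ‖v‖ • (v : EuclideanSpace ℝ (Fin n)) ∈
        Metric.sphere (0 : EuclideanSpace ℝ (Fin n)) 1 := by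
  have hx : ‖(x : EuclideanSpace ℝ (Fin n))‖ = 1 := by simp
  have hxv : inner ℝ (x : EuclideanSpace ℝ (Fin n)) (v : EuclideanSpace ℝ (Fin n)) = 0 :=
    Submodule.mem_orthogonal_singleton_iff_inner_right.mp v.2
  have hs : Real.sinc ‖v‖ * ‖v‖ = Real.sin ‖v‖ := by
    by_cases h : ‖v‖ = 0
    · simp [h]
    · rw [Real.sinc_of_ne_zero h, div_mul_cancel₀ _ h]
  have key : ‖Real.cos ‖v‖ • (x : EuclideanSpace ℝ (Fin n)) +
      Real.sinc ‖v‖ • (v : EuclideanSpace ℝ (Fin n))‖ ^ 2 = 1 := by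
    rw [norm_add_sq_real, inner_smul_left, inner_smul_right, hxv, norm_smul, norm_smul, hx]
    simp only [Real.norm_eq_abs, mul_pow, sq_abs]
    have : Real.sinc ‖v‖ ^ 2 * ‖(v : EuclideanSpace ℝ (Fin n))‖ ^ 2 = Real.sin ‖v‖ ^ 2 := by
      rw [← hs, mul_pow]; rfl
    rw [this]
    simp
  rw [mem_sphere_zero_iff_norm]
  exact (pow_eq_one_iff_of_nonneg (norm_nonneg _) two_ne_zero).mp key

/-- The Riemannian exponential map `exp_x(v) = cos |v| x + (sin |v| / |v|) v` of the round
sphere. -/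
def expMap {n : ℕ} (x : Sph n) (v : Tan x) : Sph n :=
  ⟨Real.cos ‖v‖ • (x : EuclideanSpace ℝ (Fin n)) +
    Real.sinc ‖v‖ • (v : EuclideanSpace ℝ (Fin n)), exp_mem x v⟩

/-- The c-transform `ψ^c(x) = sup_y (-c(x, y) - ψ(y))`. -/
def cTransform {n : ℕ} (ψ : Sph n → ℝ) (x : Sph n) : ℝ := ⨆ y, (-cost x y - ψ y)

/-- `φ` is a c-convex potential: it is the c-transform of some `ψ`, the supremum being finite. -/
def IsCConvex {n : ℕ} (φ : Sph n → ℝ) : Prop :=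
  ∃ ψ : Sph n → ℝ, (∀ x, BddAbove (Set.range fun y => -cost x y - ψ y)) ∧ φ = cTransform ψ

/-- The contact set `G_φ(x) = {y | φ(x) + φ^c(y) = -c(x, y)}`. -/
def contactSet {n : ℕ} (φ : Sph n → ℝ) (x : Sph n) : Set (Sph n) :=
  {y | φ x + cTransform φ y = -cost x y}

/-- The subdifferential `∂f(x)`: all `p ∈ T_x` such that
`f(y) ≥ f(x) + p · exp_x⁻¹(y) + o(d(x, y))`. Here `y` is written as `exp_x(v)` with `v` near `0`,
so that `v = exp_x⁻¹(y)` and `|v| = d(x, y)`. -/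
def subdiff {n : ℕ} (f : Sph n → ℝ) (x : Sph n) : Set (Tan x) :=
  {p | ∀ ε > 0, ∀ᶠ v : Tan x in 𝓝 0, f x + inner ℝ p v - ε * ‖v‖ ≤ f (expMap x v)}

/-- The (possibly multivalued) gradient `-∇_x c(x, y)`, the subdifferential at `x` of the
semi-convex function `-c(·, y)`. For `y ≠ -x` this function is differentiable at `x` and the set has
the single element `-∇_x c(x, y)`; for `y = -x`, where it is not differentiable, the set is the
closed ball of radius `π`. -/
def negGradCost {n : ℕ} (x y : Sph n) : Set (Tan x) := subdiff (fun z => -cost z y) x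

/-- The image `{-∇_x c(x, y) | y ∈ ω}` of a set `ω` in the tangent space at `x`. -/
def negGradImage {n : ℕ} (x : Sph n) (ω : Set (Sph n)) : Set (Tan x) :=
  ⋃ y ∈ ω, negGradCost x y

/-- `ω` is c-convex with respect to `x`: `{-∇_x c(x, y) | y ∈ ω}` is convex in `T_x`. -/
def IsCConvexSet {n : ℕ} (x : Sph n) (ω : Set (Sph n)) : Prop :=
  Convex ℝ (negGradImage x ω)

/-- The c-subdifferential `∂^cφ(x) = {-∇_x c(x, y) | y ∈ G_φ(x)}`. -/
def cSubdiff {n : ℕ} (φ : Sph n → ℝ) (x : Sph n) : Set (Tan x) :=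
  negGradImage x (contactSet φ x)

end SphereOT

end

/-!
The theorem reduces to one inclusion. A subdifferential is convex, and `∂^cφ(x) ⊆ ∂φ(x)` because
`-c(·, y) - φ^c(y)` touches `φ` from below at `x` for `y ∈ G_φ(x)`; so both claims of the first part
follow from `∂φ(x) ⊆ ∂^cφ(x)`. The second part is the triangle inequality: among all functions
`c(x, y) - c(·, y)` the largest is the one with `y = -x` (`IsCConvex.contactSet_eq_univ`).

For the inclusion, let `S` be the set of `p ∈ T_x` with `‖p‖ ≤ π` for which `y = exp_x(p)` satisfies
`c(x, y) - c(z, y) ≤ φ(z) - φ(x)` for all `z` (`supportSet`). Then `S ⊆ ∂^cφ(x)`, and following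
contact points of `φ` along a geodesic that leaves `x` in direction `v` shows that every `p ∈ ∂φ(x)`
has `⟪p, v⟫ ≤ ⟪q, v⟫` for some `q ∈ S` (`IsCConvex.exists_mem_supportSet_inner_le`). If `S` is closed
and convex, the Hahn-Banach theorem gives `∂φ(x) ⊆ S`.

The convexity of `S` is where the geometry of the sphere enters: for every `z` the function
`p ↦ ‖p‖² / 2 - d(z, exp_x(p))² / 2` is convex on `T_x` (`convexOn_sq_norm_sub_cost`). The reason is
that the sphere is the base of a Riemannian submersion from a Hilbert space, the space of curves in
the Lie algebra of skew-symmetric maps, under which the line of constant curves `s (p ∧ x)` is a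
horizontal lift of the geodesic `s ↦ exp_x(s p)`. In a Hilbert space `‖p‖² - ‖p - u‖²` is affine in `p`, and the function in
question is a supremum of such affine functions. Concretely, given `p₀`, put `y = exp_x(p₀)`,
`z = exp_y(ζ)` with `‖ζ‖ = d(y, z)`; for every `p` the curve
`t ↦ exp(t (ζ ∧ y)) exp(t (p₀ ∧ x)) exp((1 - t) (p ∧ x)) x` joins `exp_x(p)` to `z`, and its energy is
at most `‖ζ‖² + ‖p₀ - p‖² + 2 ⟪W, p₀ - p⟫` with `W` independent of `p`
(`exists_sq_angle_rot_le`). This yields a supporting affine function at `p₀`, and for `ζ = 0` it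
says that `exp_x` does not increase distances (`sdist_expMap_expMap_le`).
-/

open Filter Topology

noncomputable section

namespace SphereOT

/-! ### Bivectors and skew-symmetric maps -/

/-- The bivector `a ∧ b` of `ℝ^n`, encoded as the matrix of its coefficients
`(a_i b_j - a_j b_i) / √2`, so that the Euclidean norm of the matrix is the usual norm
`‖a‖² ‖b‖² - ⟪a, b⟫²` of bivectors. -/
def wedge {n : ℕ} (a b : EuclideanSpace ℝ (Fin n)) : EuclideanSpace ℝ (Fin n × Fin n) :=
  WithLp.toLp 2 fun i => (a i.1 * b i.2 - a i.2 * b i.1) / √2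

theorem inner_wedge {n : ℕ} (a b c d : EuclideanSpace ℝ (Fin n)) :
    inner ℝ (wedge a b) (wedge c d) =
      inner ℝ a c * inner ℝ b d - inner ℝ a d * inner ℝ b c := by
  have h2 : (√2 : ℝ) * √2 = 2 := Real.mul_self_sqrt (by norm_num)
  have key : ∀ i j : Fin n, (a i * b j - a j * b i) / √2 * ((c i * d j - c j * d i) / √2) =
      ((a i * c i) * (b j * d j) - (a i * d i) * (b j * c j)
        + ((b i * d i) * (a j * c j) - (b i * c i) * (a j * d j))) / 2 := by
    intro i j
    rw [div_mul_div_comm, h2]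
    ring
  simp only [wedge, PiLp.inner_apply, RCLike.inner_apply, conj_trivial, Fintype.sum_prod_type]
  have : ∀ i j : Fin n, (c i * d j - c j * d i) / √2 * ((a i * b j - a j * b i) / √2) =
      ((c i * a i) * (d j * b j) - (d i * a i) * (c j * b j)
        + ((d i * b i) * (c j * a j) - (c i * b i) * (d j * a j))) / 2 := by
    intro i j
    rw [mul_comm, key]
    ring
  simp only [this, ← Finset.sum_div, Finset.sum_add_distrib, Finset.sum_sub_distrib,
    ← Finset.mul_sum, ← Finset.sum_mul]
  ring

/-- The operator norm of the skew-symmetric map attached to the bivector `a ∧ b + q ∧ x` is at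
most the norm of the bivector: if `w` is the image of the unit vector `v`, then `‖w‖²` is the inner
product of the bivector with `w ∧ v`, and the Cauchy-Schwarz inequality applies. -/
theorem norm_sq_skew_apply_le {n : ℕ} {a b q x v : EuclideanSpace ℝ (Fin n)}
    (hb : ‖b‖ = 1) (hab : inner ℝ a b = 0) (hx : ‖x‖ = 1) (hqx : inner ℝ q x = 0)
    (hv : ‖v‖ = 1) :
    ‖(inner ℝ b v • a - inner ℝ a v • b) + (inner ℝ x v • q - inner ℝ q v • x)‖ ^ 2 ≤
      ‖a‖ ^ 2 + ‖q‖ ^ 2 + 2 * (inner ℝ a q * inner ℝ b x - inner ℝ a x * inner ℝ b q) := by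
  set w := (inner ℝ b v • a - inner ℝ a v • b) + (inner ℝ x v • q - inner ℝ q v • x) with hw
  set Ω := wedge a b + wedge q x with hΩ
  have hvv : inner ℝ v v = (1 : ℝ) := by simp [hv]
  have h1 : inner ℝ Ω (wedge w v) = ‖w‖ ^ 2 := by
    rw [hΩ, inner_add_left, inner_wedge, inner_wedge, ← real_inner_self_eq_norm_sq w]
    conv_rhs => rw [hw]
    simp only [inner_add_left, inner_sub_left, inner_smul_left, conj_trivial]
    ring
  have h2 : ‖Ω‖ ^ 2 =
      ‖a‖ ^ 2 + ‖q‖ ^ 2 + 2 * (inner ℝ a q * inner ℝ b x - inner ℝ a x * inner ℝ b q) := by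
    rw [hΩ, norm_add_sq_real, ← real_inner_self_eq_norm_sq (wedge a b),
      ← real_inner_self_eq_norm_sq (wedge q x), inner_wedge, inner_wedge, inner_wedge, hab, hqx]
    simp only [real_inner_self_eq_norm_sq, hb, hx]
    ring
  have h3 : ‖wedge w v‖ ^ 2 ≤ ‖w‖ ^ 2 := by
    rw [← real_inner_self_eq_norm_sq, inner_wedge, hvv, real_inner_self_eq_norm_sq,
      real_inner_comm w v]
    nlinarith [sq_nonneg (inner ℝ w v)]
  rw [← h2]
  have h4 : ‖w‖ ^ 2 ≤ ‖Ω‖ * ‖w‖ := by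
    rw [← h1]
    exact (real_inner_le_norm _ _).trans (mul_le_mul_of_nonneg_left
      ((sq_le_sq₀ (norm_nonneg _) (norm_nonneg _)).mp h3) (norm_nonneg _))
  have h5 : ‖w‖ ≤ ‖Ω‖ := by
    by_contra! h
    nlinarith [norm_nonneg Ω]
  gcongr

section Rotations

variable {E : Type*} [NormedAddCommGroup E] [InnerProductSpace ℝ E]

/-- The skew-symmetric map of the bivector `p ∧ x`: for a unit vector `x` and `p ⊥ x`, the
infinitesimal rotation of the plane of `x` and `p` that moves `x` with velocity `p`. -/
def rotGen (x p : E) : E →L[ℝ] E :=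
  (innerSL ℝ x).smulRight p - (innerSL ℝ p).smulRight x

theorem rotGen_apply (x p v : E) : rotGen x p v = inner ℝ x v • p - inner ℝ p v • x := rfl

/-- The rotation by time `t` along `rotGen x p`. -/
def rot (x p : E) (t : ℝ) : E →L[ℝ] E := NormedSpace.exp (t • rotGen x p)

@[simp] theorem rot_zero (x p : E) : rot x p 0 = 1 := by simp [rot]

variable [CompleteSpace E]

theorem rotGen_mem_skewAdjoint (x p : E) : rotGen x p ∈ skewAdjoint (E →L[ℝ] E) := by
  rw [skewAdjoint.mem_iff, ContinuousLinearMap.star_eq_adjoint, eq_comm,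
    ContinuousLinearMap.eq_adjoint_iff]
  intro v w
  simp only [neg_apply, rotGen_apply, inner_neg_left, inner_sub_left,
    inner_sub_right, inner_smul_left, inner_smul_right, conj_trivial]
  rw [real_inner_comm p v, real_inner_comm x v]
  ring

theorem rot_mem_unitary (x p : E) (t : ℝ) : rot x p t ∈ unitary (E →L[ℝ] E) :=
  let : NormedAlgebra ℚ (E →L[ℝ] E) := NormedAlgebra.restrictScalars ℚ ℝ _
  NormedSpace.exp_mem_unitary_of_mem_skewAdjoint
    (skewAdjoint.smul_mem t (rotGen_mem_skewAdjoint x p))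

theorem inner_rot_rot (x p : E) (t : ℝ) (v w : E) :
    inner ℝ (rot x p t v) (rot x p t w) = inner ℝ v w :=
  ContinuousLinearMap.inner_map_map_of_mem_unitary (rot_mem_unitary x p t) v w

theorem norm_rot (x p : E) (t : ℝ) (v : E) : ‖rot x p t v‖ = ‖v‖ :=
  ContinuousLinearMap.norm_map_of_mem_unitary (rot_mem_unitary x p t) v

theorem hasDerivAt_rot (x p : E) (t : ℝ) :
    HasDerivAt (rot x p) (rot x p t * rotGen x p) t :=
  hasDerivAt_exp_smul_const (rotGen x p) t

theorem hasDerivAt_rot' (x p : E) (t : ℝ) :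
    HasDerivAt (rot x p) (rotGen x p * rot x p t) t :=
  hasDerivAt_exp_smul_const' (rotGen x p) t

theorem continuous_rot (x p : E) : Continuous (rot x p) :=
  continuous_iff_continuousAt.mpr fun t => (hasDerivAt_rot x p t).continuousAt

theorem rot_mul_rot_neg (x p : E) (t : ℝ) : rot x p t * rot x p (-t) = 1 := by
  let : NormedAlgebra ℚ (E →L[ℝ] E) := NormedAlgebra.restrictScalars ℚ ℝ _
  rw [rot, rot, neg_smul, ← NormedSpace.exp_add_of_commute (Commute.refl _).neg_right,
    add_neg_cancel, NormedSpace.exp_zero]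

theorem rot_rot_neg (x p : E) (t : ℝ) (v : E) : rot x p t (rot x p (-t) v) = v :=
  DFunLike.congr_fun (rot_mul_rot_neg x p t) v

/-- The orbit of `x` under the rotations generated by `rotGen x p` is the geodesic with initial
velocity `p`: both solve the same linear differential equation. -/
theorem rot_one_apply {x p : E} (hx : ‖x‖ = 1) (hxp : inner ℝ x p = 0) :
    rot x p 1 x = Real.cos ‖p‖ • x + Real.sinc ‖p‖ • p := by
  by_cases hp : p = 0
  · subst hp
    have : rotGen x (0 : E) = 0 := by ext v; simp [rotGen_apply]
    simp [rot, this]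
  have hr : ‖p‖ ≠ 0 := norm_ne_zero_iff.mpr hp
  set y : ℝ → E := fun t => Real.cos (t * ‖p‖) • x + (Real.sin (t * ‖p‖) / ‖p‖) • p with hy
  have hy' : ∀ t, HasDerivAt y (rotGen x p (y t)) t := by
    intro t
    have h0 : HasDerivAt (fun t : ℝ => t * ‖p‖) ‖p‖ t := by
      simpa using (hasDerivAt_id t).mul_const ‖p‖
    have := (h0.cos.smul_const x).add ((h0.sin.div_const ‖p‖).smul_const p)
    refine this.congr_deriv ?_
    have hpx : inner ℝ p x = (0 : ℝ) := by rw [real_inner_comm, hxp]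
    have hxx : inner ℝ x x = (1 : ℝ) := by simp [hx]
    have hpp : inner ℝ p p = ‖p‖ * ‖p‖ := real_inner_self_eq_norm_mul_norm p
    simp only [hy, rotGen_apply, inner_add_right, inner_smul_right, hxp, hpx, hxx, hpp]
    match_scalars
    · field_simp
      ring
    · field_simp
      ring
  have hconst : ∀ t, HasDerivAt (fun t => rot x p (-t) (y t)) 0 t := by
    intro t
    have h1 : HasDerivAt (fun t => rot x p (-t)) (-(rot x p (-t) * rotGen x p)) t := by
      have := (hasDerivAt_rot x p (-t)).scomp t (hasDerivAt_neg t)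
      rw [neg_one_smul] at this
      exact this
    refine (h1.clm_apply (hy' t)).congr_deriv ?_
    simp
  have h2 := is_const_of_deriv_eq_zero (fun t => (hconst t).differentiableAt)
    (fun t => (hconst t).deriv) 1 0
  have h3 := congrArg (rot x p 1) h2
  rw [rot_rot_neg] at h3
  simp only [hy, one_mul, zero_mul, Real.cos_zero, Real.sin_zero, zero_div, neg_zero, rot_zero,
    zero_smul, add_zero, one_smul, one_apply_eq_self] at h3
  rw [← h3, Real.sinc_of_ne_zero hr]

end Rotations

/-! ### Lengths of curves on the unit sphere -/

section Length

variable {E : Type*} [NormedAddCommGroup E] [InnerProductSpace ℝ E]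

theorem angle_le_chord {a b : E} (ha : ‖a‖ = 1) (hb : ‖b‖ = 1) :
    InnerProductGeometry.angle a b ≤ ‖b - a‖ * (1 + ‖b - a‖ ^ 2) := by
  set θ := InnerProductGeometry.angle a b with hθ
  have h0 : 0 ≤ θ := InnerProductGeometry.angle_nonneg a b
  have hπ : θ ≤ Real.pi := InnerProductGeometry.angle_le_pi a b
  have hs0 : 0 ≤ Real.sin (θ / 2) := Real.sin_nonneg_of_nonneg_of_le_pi (by linarith) (by linarith)
  have hc : ‖b - a‖ = 2 * Real.sin (θ / 2) := by
    have h1 : ‖b - a‖ ^ 2 = (2 * Real.sin (θ / 2)) ^ 2 := by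
      have h3 : inner ℝ b a = Real.cos θ := by
        rw [hθ, InnerProductGeometry.cos_angle, ha, hb, real_inner_comm]; simp
      rw [norm_sub_sq_real, ha, hb, h3, mul_pow, Real.sin_sq_eq_half_sub]
      rw [show 2 * (θ / 2) = θ by ring]
      ring
    exact (sq_eq_sq₀ (norm_nonneg _) (by positivity)).mp h1
  rw [hc]
  rcases h0.eq_or_lt with h0 | h0
  · rw [← h0]; simp
  have h1 := Real.sin_gt_sub_cube (x := θ / 2) (by linarith)
  have h2 : 2 / Real.pi * (θ / 2) ≤ Real.sin (θ / 2) :=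
    Real.mul_le_sin (by linarith) (by linarith)
  have h3 : θ / 2 ≤ 2 * Real.sin (θ / 2) := by
    rw [div_mul_eq_mul_div, div_le_iff₀ Real.pi_pos] at h2
    nlinarith [Real.pi_le_four]
  have h4 : (θ / 2) ^ 3 ≤ (2 * Real.sin (θ / 2)) ^ 3 := by gcongr
  nlinarith [pow_nonneg hs0 3]

theorem tendsto_angle_slope_lt {m : ℝ → E} {m' : E} {s r : ℝ} (hm : ∀ t, ‖m t‖ = 1)
    (hd : HasDerivAt m m' s) (hr : ‖m'‖ < r) :
    ∀ᶠ z in 𝓝[>] s, InnerProductGeometry.angle (m s) (m z) < r * (z - s) := by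
  have h1 : Tendsto (fun z => ‖slope m s z‖ * (1 + ‖m z - m s‖ ^ 2)) (𝓝[>] s) (𝓝 ‖m'‖) := by
    have ha : Tendsto (slope m s) (𝓝[>] s) (𝓝 m') :=
      (hasDerivAt_iff_tendsto_slope.mp hd).mono_left
        (nhdsWithin_mono _ fun z hz => ne_of_gt hz)
    have hb : Tendsto (fun z => ‖m z - m s‖ ^ 2) (𝓝[>] s) (𝓝 (‖m s - m s‖ ^ 2)) :=
      (((hd.continuousAt.tendsto).mono_left nhdsWithin_le_nhds).sub_const _).norm.pow 2
    simpa using ha.norm.mul (hb.const_add 1)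
  filter_upwards [h1.eventually_lt_const hr, self_mem_nhdsWithin] with z hz hzs
  have hpos : 0 < z - s := sub_pos.mpr hzs
  refine (angle_le_chord (hm s) (hm z)).trans_lt ?_
  have h2 : ‖m z - m s‖ = ‖slope m s z‖ * (z - s) := by
    rw [slope_def_module, norm_smul, norm_inv, Real.norm_of_nonneg hpos.le]
    field_simp
  calc ‖m z - m s‖ * (1 + ‖m z - m s‖ ^ 2)
      = ‖slope m s z‖ * (1 + ‖m z - m s‖ ^ 2) * (z - s) := by
        rw [h2]; ring
    _ < r * (z - s) := by gcongr

/-- The squared angle between the endpoints of a curve on the unit sphere is at most its energy. -/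
theorem sq_angle_le_integral {m m' : ℝ → E} {V : ℝ → ℝ} (hm : ∀ t, ‖m t‖ = 1)
    (hd : ∀ t, HasDerivAt m (m' t) t) (hV : Continuous V) (hle : ∀ t, ‖m' t‖ ^ 2 ≤ V t) :
    InnerProductGeometry.angle (m 0) (m 1) ^ 2 ≤ ∫ t in (0 : ℝ)..1, V t := by
  set D := InnerProductGeometry.angle (m 0) (m 1) with hD
  have hI0 : 0 ≤ ∫ t in (0 : ℝ)..1, V t :=
    intervalIntegral.integral_nonneg zero_le_one fun t _ => (sq_nonneg _).trans (hle t)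
  rcases (InnerProductGeometry.angle_nonneg (m 0) (m 1)).eq_or_lt with h0 | h0
  · rw [hD, ← h0]; simpa using hI0
  rw [← hD] at h0
  have hmc : Continuous m := continuous_iff_continuousAt.mpr fun t => (hd t).continuousAt
  have hm0 : ∀ t, m t ≠ 0 := fun t h => by simpa [h] using hm t
  have hfc : Continuous fun t => InnerProductGeometry.angle (m 0) (m t) :=
    continuous_iff_continuousAt.mpr fun t =>
      (InnerProductGeometry.continuousAt_angle (x := (m 0, m t)) (hm0 0) (hm0 t)).comp
        (f := fun t => (m 0, m t)) (by fun_prop)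
  -- The speed is bounded by the mean of `V t / D` and `D`, which turns the length bound into
  -- the energy bound.
  set B : ℝ → ℝ := fun u => ((∫ t in (0 : ℝ)..u, V t) / D + D * u) / 2 with hB
  have hBd : ∀ t, HasDerivAt B ((V t / D + D) / 2) t := by
    intro t
    have h1 : HasDerivAt (fun u => ∫ s in (0 : ℝ)..u, V s) (V t) t :=
      intervalIntegral.integral_hasDerivAt_right (hV.intervalIntegrable _ _)
        hV.stronglyMeasurable.stronglyMeasurableAtFilter hV.continuousAt
    have h2 : HasDerivAt (fun u : ℝ => D * u) D t := by
      simpa using (hasDerivAt_id t).const_mul D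
    exact ((h1.div_const D).add h2).div_const 2
  have hspeed : ∀ t, ‖m' t‖ ≤ (V t / D + D) / 2 := by
    intro t
    have h1 : ‖m' t‖ ^ 2 / D ≤ V t / D := by gcongr; exact hle t
    have h2 : 2 * ‖m' t‖ ≤ ‖m' t‖ ^ 2 / D + D := by
      have : ‖m' t‖ ^ 2 / D + D - 2 * ‖m' t‖ = (‖m' t‖ - D) ^ 2 / D := by field_simp; ring
      have h3 : 0 ≤ (‖m' t‖ - D) ^ 2 / D := by positivity
      linarith
    linarith
  have := image_le_of_liminf_slope_right_le_deriv_boundary (a := 0) (b := 1)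
    (f := fun t => InnerProductGeometry.angle (m 0) (m t)) hfc.continuousOn (B := B)
    (B' := fun t => (V t / D + D) / 2) (by simp [hB, InnerProductGeometry.angle_self (hm0 0)])
    (fun t _ => (hBd t).continuousAt.continuousWithinAt) (fun t _ => (hBd t).hasDerivWithinAt)
    (fun s _ r hr => by
      refine Eventually.frequently ?_
      filter_upwards [tendsto_angle_slope_lt hm (hd s) ((hspeed s).trans_lt hr),
        self_mem_nhdsWithin] with z hz hzs
      have hpos : 0 < z - s := sub_pos.mpr hzs
      rw [slope_def_field, div_lt_iff₀ hpos]
      have := InnerProductGeometry.angle_le_angle_add_angle (m 0) (m s) (m z)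
      linarith)
    (Set.right_mem_Icc.mpr zero_le_one)
  simp only [hB, ← hD, mul_one] at this
  have h3 : D ≤ (∫ t in (0 : ℝ)..1, V t) / D := by linarith
  rwa [le_div_iff₀ h0, ← sq] at h3

end Length

/-! ### A comparison inequality for the exponential map -/

/-- Let `γ(t) = exp(t (ζ ∧ y)) exp(t (p₀ ∧ x))` be a curve of rotations, `y = exp_x(p₀)`. The
curve `t ↦ γ(t) exp((1 - t) (p ∧ x)) x` joins `exp_x(p)` to `exp_y(ζ)` for every `p`, and its
energy is bounded by a quadratic polynomial in `p` whose second order part is that of `‖p‖²`. -/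
theorem exists_sq_angle_rot_le {n : ℕ} {x p₀ y ζ : EuclideanSpace ℝ (Fin n)} (hx : ‖x‖ = 1)
    (hp₀ : inner ℝ x p₀ = 0) (hy : y = rot x p₀ 1 x) (hζ : inner ℝ ζ y = 0) :
    ∃ W : EuclideanSpace ℝ (Fin n), (ζ = 0 → W = 0) ∧ ∀ p, inner ℝ x p = 0 →
      InnerProductGeometry.angle (rot x p 1 x) (rot y ζ 1 y) ^ 2 ≤
        ‖ζ‖ ^ 2 + ‖p₀ - p‖ ^ 2 + 2 * inner ℝ W (p₀ - p) := by
  set a : ℝ → EuclideanSpace ℝ (Fin n) := fun t => rot x p₀ (-t) ζ with ha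
  set b : ℝ → EuclideanSpace ℝ (Fin n) := fun t => rot x p₀ (-t) y with hb
  have hac : Continuous a := ((continuous_rot x p₀).comp continuous_neg).clm_apply continuous_const
  have hbc : Continuous b := ((continuous_rot x p₀).comp continuous_neg).clm_apply continuous_const
  set k : ℝ → EuclideanSpace ℝ (Fin n) := fun t => inner ℝ (b t) x • a t - inner ℝ (a t) x • b t
    with hk
  have hkc : Continuous k := by fun_prop
  have hyn : ‖y‖ = 1 := by rw [hy, norm_rot, hx]
  refine ⟨∫ t in (0 : ℝ)..1, k t, ?_, ?_⟩
  · rintro rfl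
    simp [hk, ha]
  intro p hp
  set ξ : ℝ → EuclideanSpace ℝ (Fin n) := fun t => rot x p (1 - t) x with hξ
  have hξd : ∀ t, HasDerivAt ξ (-(rotGen x p (ξ t))) t := by
    intro t
    have h1 := (hasDerivAt_rot' x p (1 - t)).scomp t ((hasDerivAt_id t).const_sub 1)
    rw [neg_one_smul] at h1
    refine (HasDerivAt.clm_apply h1 (hasDerivAt_const t x)).congr_deriv ?_
    simp [hξ]
  have hd : ∀ t, HasDerivAt (fun t => rot y ζ t (rot x p₀ t (ξ t)))
      (rot y ζ t (rot x p₀ t ((inner ℝ (b t) (ξ t) • a t - inner ℝ (a t) (ξ t) • b t) +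
        (inner ℝ x (ξ t) • (p₀ - p) - inner ℝ (p₀ - p) (ξ t) • x)))) t := by
    intro t
    have h1 := (hasDerivAt_rot y ζ t).clm_apply ((hasDerivAt_rot x p₀ t).clm_apply (hξd t))
    refine h1.congr_deriv ?_
    have e1 : rotGen y ζ (rot x p₀ t (ξ t)) =
        rot x p₀ t (inner ℝ (b t) (ξ t) • a t - inner ℝ (a t) (ξ t) • b t) := by
      rw [map_sub, map_smul, map_smul, rotGen_apply, ← inner_rot_rot x p₀ t (b t),
        ← inner_rot_rot x p₀ t (a t)]
      simp only [ha, hb, rot_rot_neg]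
    rw [mul_apply_eq_comp, e1, mul_apply_eq_comp, ← map_add, ← map_add,
      ← map_add]
    congr 3
    simp only [rotGen_apply, inner_sub_left]
    module
  have hm : ∀ t, ‖rot y ζ t (rot x p₀ t (ξ t))‖ = 1 := fun t => by
    rw [norm_rot, norm_rot, hξ, norm_rot, hx]
  have h := sq_angle_le_integral hm hd
    (V := fun t => ‖ζ‖ ^ 2 + ‖p₀ - p‖ ^ 2 + 2 * inner ℝ (k t) (p₀ - p)) (by fun_prop) (by
      intro t
      rw [norm_rot, norm_rot]
      have h1 := norm_sq_skew_apply_le (a := a t) (b := b t) (q := p₀ - p) (x := x) (v := ξ t)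
        (by rw [hb, norm_rot, hyn]) (by rw [ha, hb, inner_rot_rot, hζ]) hx
        (by rw [real_inner_comm, inner_sub_right, hp₀, hp, sub_zero]) (by rw [hξ, norm_rot, hx])
      refine h1.trans_eq ?_
      rw [show ‖a t‖ = ‖ζ‖ from norm_rot _ _ _ _]
      simp only [hk, inner_sub_left, inner_smul_left, conj_trivial]
      ring)
  simp only [hξ, rot_zero, sub_zero, sub_self, one_apply_eq_self, ← hy] at h
  refine h.trans_eq ?_
  have hkq : ∫ t in (0 : ℝ)..1, inner ℝ (k t) (p₀ - p) =
      inner ℝ (∫ t in (0 : ℝ)..1, k t) (p₀ - p) := by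
    simp only [real_inner_comm (p₀ - p)]
    exact (innerSL ℝ (p₀ - p)).intervalIntegral_comp_comm (hkc.intervalIntegrable 0 1)
  rw [intervalIntegral.integral_add (by simp)
    (Continuous.intervalIntegrable (by fun_prop) _ _), intervalIntegral.integral_const_mul, hkq]
  simp

variable {n : ℕ}

theorem norm_coe_sph (x : Sph n) : ‖(x : EuclideanSpace ℝ (Fin n))‖ = 1 := by simp

theorem inner_coe_tan (x : Sph n) (v : Tan x) :
    inner ℝ (x : EuclideanSpace ℝ (Fin n)) (v : EuclideanSpace ℝ (Fin n)) = 0 :=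
  Submodule.mem_orthogonal_singleton_iff_inner_right.mp v.2

theorem sdist_eq_angle (x y : Sph n) :
    sdist x y =
      InnerProductGeometry.angle (x : EuclideanSpace ℝ (Fin n)) (y : EuclideanSpace ℝ (Fin n)) := by
  simp [sdist, InnerProductGeometry.angle]

theorem sdist_comm (x y : Sph n) : sdist x y = sdist y x := by
  simp only [sdist_eq_angle, InnerProductGeometry.angle_comm]

theorem sdist_nonneg (x y : Sph n) : 0 ≤ sdist x y := Real.arccos_nonneg _

theorem sdist_le_pi (x y : Sph n) : sdist x y ≤ Real.pi := Real.arccos_le_pi _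

theorem sdist_triangle (x y z : Sph n) : sdist x z ≤ sdist x y + sdist y z := by
  simp only [sdist_eq_angle]
  exact InnerProductGeometry.angle_le_angle_add_angle _ _ _

theorem cost_comm (x y : Sph n) : cost x y = cost y x := by
  rw [cost, cost, sdist_comm]

theorem continuous_sdist : Continuous fun q : Sph n × Sph n => sdist q.1 q.2 := by
  unfold sdist
  exact Real.continuous_arccos.comp (by fun_prop)

theorem continuous_cost : Continuous fun q : Sph n × Sph n => cost q.1 q.2 := by
  unfold cost
  exact (continuous_sdist.pow 2).div_const 2

theorem tendsto_cost {ι : Type*} {l : Filter ι} {f g : ι → Sph n} {x y : Sph n}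
    (hf : Tendsto f l (𝓝 x)) (hg : Tendsto g l (𝓝 y)) :
    Tendsto (fun i => cost (f i) (g i)) l (𝓝 (cost x y)) := by
  have h := (continuous_cost.tendsto (x, y)).comp (hf.prodMk_nhds hg)
  simpa only [Function.comp_def] using h

theorem coe_expMap_eq_rot (x : Sph n) (v : Tan x) :
    (expMap x v : EuclideanSpace ℝ (Fin n)) = rot (x : EuclideanSpace ℝ (Fin n)) v 1 x :=
  (rot_one_apply (norm_coe_sph x) (inner_coe_tan x v)).symm

/-- For fixed `p₀` and `z = exp_y(ζ)`, `y = exp_x(p₀)`, the function `p ↦ ‖p‖² - d(z, exp_x(p))²`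
is bounded below by an affine function of `p`, with equality at `p₀` if `‖ζ‖ = d(y, z)`. -/
theorem exists_sq_sdist_expMap_le (x : Sph n) (p₀ : Tan x) (ζ : Tan (expMap x p₀)) :
    ∃ W : EuclideanSpace ℝ (Fin n), (ζ = 0 → W = 0) ∧ ∀ p : Tan x,
      sdist (expMap (expMap x p₀) ζ) (expMap x p) ^ 2 ≤
        ‖ζ‖ ^ 2 + ‖p₀ - p‖ ^ 2 + 2 * inner ℝ W ((p₀ - p : Tan x) : EuclideanSpace ℝ (Fin n)) := by
  obtain ⟨W, hW0, hW⟩ := exists_sq_angle_rot_le (norm_coe_sph x) (inner_coe_tan x p₀)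
    (coe_expMap_eq_rot x p₀) ((real_inner_comm _ _).trans (inner_coe_tan _ ζ))
  refine ⟨W, fun h => hW0 (by simp [h]), fun p => ?_⟩
  have := hW p (inner_coe_tan x p)
  rwa [← coe_expMap_eq_rot, ← coe_expMap_eq_rot, ← sdist_eq_angle, sdist_comm] at this

@[simp] theorem expMap_zero (x : Sph n) : expMap x 0 = x := by
  ext1
  simp [expMap]

/-- The exponential map of the round sphere does not increase distances. -/
theorem sdist_expMap_expMap_le (x : Sph n) (w p : Tan x) :
    sdist (expMap x w) (expMap x p) ≤ ‖w - p‖ := by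
  obtain ⟨W, hW0, hW⟩ := exists_sq_sdist_expMap_le x w 0
  have := hW p
  rw [hW0 rfl, expMap_zero] at this
  simp only [norm_zero, inner_zero_left] at this
  exact (sq_le_sq₀ (sdist_nonneg _ _) (norm_nonneg _)).mp (by linarith)

theorem inner_coe_expMap (x : Sph n) (v : Tan x) :
    inner ℝ (x : EuclideanSpace ℝ (Fin n)) (expMap x v : EuclideanSpace ℝ (Fin n)) =
      Real.cos ‖v‖ := by
  simp [expMap, inner_add_right, inner_smul_right, inner_coe_tan]

theorem sdist_expMap (x : Sph n) {v : Tan x} (hv : ‖v‖ ≤ Real.pi) :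
    sdist x (expMap x v) = ‖v‖ := by
  rw [sdist, inner_coe_expMap, Real.arccos_cos (norm_nonneg _) hv]

theorem cost_expMap (x : Sph n) {v : Tan x} (hv : ‖v‖ ≤ Real.pi) :
    cost x (expMap x v) = ‖v‖ ^ 2 / 2 := by
  rw [cost, sdist_expMap x hv]

/-- The restriction on the dimension is needed for `y = -x` only: on the two points of `S^0` the
tangent spaces are trivial. -/
theorem exists_expMap_eq (hn : 2 ≤ n) (x y : Sph n) :
    ∃ v : Tan x, expMap x v = y ∧ ‖v‖ = sdist x y := by
  have hxx : inner ℝ (x : EuclideanSpace ℝ (Fin n)) (x : EuclideanSpace ℝ (Fin n)) = (1 : ℝ) := by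
    simp
  have hyy : inner ℝ (y : EuclideanSpace ℝ (Fin n)) (y : EuclideanSpace ℝ (Fin n)) = (1 : ℝ) := by
    simp
  set c : ℝ := inner ℝ (x : EuclideanSpace ℝ (Fin n)) (y : EuclideanSpace ℝ (Fin n)) with hc
  have habs : |c| ≤ 1 := by
    simpa using abs_real_inner_le_norm (x : EuclideanSpace ℝ (Fin n)) (y : EuclideanSpace ℝ (Fin n))
  set u : EuclideanSpace ℝ (Fin n) := y - c • x with hu
  have hux : inner ℝ (x : EuclideanSpace ℝ (Fin n)) u = 0 := by
    rw [hu, inner_sub_right, inner_smul_right, hxx, ← hc]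
    ring
  have hcos : Real.cos (sdist x y) = c :=
    Real.cos_arccos (abs_le.mp habs).1 (abs_le.mp habs).2
  have hsin0 : 0 ≤ Real.sin (sdist x y) :=
    Real.sin_nonneg_of_nonneg_of_le_pi (sdist_nonneg x y) (sdist_le_pi x y)
  have hsin : Real.sin (sdist x y) = ‖u‖ := by
    refine (sq_eq_sq₀ hsin0 (norm_nonneg _)).mp ?_
    rw [Real.sin_sq, hcos, ← real_inner_self_eq_norm_sq, hu]
    simp only [inner_sub_left, inner_sub_right, inner_smul_left, inner_smul_right, hxx, hyy,
      conj_trivial, real_inner_comm (x : EuclideanSpace ℝ (Fin n)) y, ← hc]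
    ring
  -- A unit tangent vector `e` with `y = cos d(x, y) x + sin d(x, y) e`.
  obtain ⟨e, he1, heu⟩ : ∃ e : Tan x, ‖e‖ = 1 ∧ ‖u‖ • (e : EuclideanSpace ℝ (Fin n)) = u := by
    by_cases h0 : u = 0
    · have hfr : 0 < Module.finrank ℝ (Tan x) := by
        have h1 := Submodule.finrank_add_finrank_orthogonal
          (Submodule.span ℝ {(x : EuclideanSpace ℝ (Fin n))})
        have h2 := finrank_span_singleton (K := ℝ)
          (v := (x : EuclideanSpace ℝ (Fin n))) (by intro h; simp [h] at hxx)
        rw [finrank_euclideanSpace_fin, h2] at h1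
        change 0 < Module.finrank ℝ ↥(Submodule.span ℝ {(x : EuclideanSpace ℝ (Fin n))})ᗮ
        omega
      have := Module.finrank_pos_iff.mp hfr
      obtain ⟨e, he⟩ := exists_norm_eq (Tan x) (zero_le_one (α := ℝ))
      exact ⟨e, he, by simp [h0]⟩
    · have hu0 : ‖u‖ ≠ 0 := norm_ne_zero_iff.mpr h0
      refine ⟨‖u‖⁻¹ • ⟨u, Submodule.mem_orthogonal_singleton_iff_inner_right.mpr hux⟩, ?_, ?_⟩
      · rw [norm_smul, norm_inv, norm_norm]
        exact inv_mul_cancel₀ hu0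
      · simp [smul_smul, hu0]
  have hnorm : ‖sdist x y • e‖ = sdist x y := by
    rw [norm_smul, he1, mul_one, Real.norm_of_nonneg (sdist_nonneg x y)]
  refine ⟨sdist x y • e, ?_, hnorm⟩
  have hsinc : Real.sinc (sdist x y) * sdist x y = ‖u‖ := by
    rw [← hsin]
    by_cases h : sdist x y = 0
    · simp [h]
    · rw [Real.sinc_of_ne_zero h, div_mul_cancel₀ _ h]
  ext1
  simp only [expMap, hnorm, Submodule.coe_smul, smul_smul, hsinc, heu, hcos]
  rw [hu]
  module

/-- Convexity of `p ↦ ‖p‖² / 2 - c(z, exp_x(p))` on the tangent space, the form in which the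
nonnegative cross-curvature of the round sphere enters. -/
theorem convexOn_sq_norm_sub_cost (hn : 2 ≤ n) (x z : Sph n) :
    ConvexOn ℝ Set.univ fun p : Tan x => ‖p‖ ^ 2 / 2 - cost z (expMap x p) := by
  refine ⟨convex_univ, fun p _ q _ s t hs ht hst => ?_⟩
  set p₀ : Tan x := s • p + t • q with hp₀
  obtain ⟨ζ, hζ, hζn⟩ := exists_expMap_eq hn (expMap x p₀) z
  obtain ⟨W, -, hW⟩ := exists_sq_sdist_expMap_le x p₀ ζ
  rw [hζ] at hW
  have hp := mul_le_mul_of_nonneg_left (hW p) hs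
  have hq := mul_le_mul_of_nonneg_left (hW q) ht
  rw [hζn, sdist_comm _ z] at hp hq
  have hlin : s * inner ℝ W ((p₀ - p : Tan x) : EuclideanSpace ℝ (Fin n)) +
      t * inner ℝ W ((p₀ - q : Tan x) : EuclideanSpace ℝ (Fin n)) = 0 := by
    rw [← inner_smul_right, ← inner_smul_right, ← inner_add_right, ← Submodule.coe_smul,
      ← Submodule.coe_smul, ← Submodule.coe_add]
    have ht1 : t = 1 - s := by linarith
    have : s • (p₀ - p) + t • (p₀ - q) = 0 := by
      rw [hp₀, ht1]
      module
    rw [this]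
    simp
  have hquad : s * ‖p₀ - p‖ ^ 2 + t * ‖p₀ - q‖ ^ 2 = s * ‖p‖ ^ 2 + t * ‖q‖ ^ 2 - ‖p₀‖ ^ 2 := by
    have h1 : s * inner ℝ p₀ p + t * inner ℝ p₀ q = ‖p₀‖ ^ 2 := by
      rw [← inner_smul_right, ← inner_smul_right, ← inner_add_right, ← hp₀,
        real_inner_self_eq_norm_sq]
    rw [norm_sub_sq_real, norm_sub_sq_real]
    linear_combination ‖p₀‖ ^ 2 * hst - 2 * h1
  simp only [cost, smul_eq_mul]
  nlinarith

/-! ### c-transforms and contact sets -/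

theorem cost_nonneg (x y : Sph n) : 0 ≤ cost x y := by
  unfold cost
  positivity

theorem cost_le (x y : Sph n) : cost x y ≤ Real.pi ^ 2 / 2 := by
  unfold cost
  gcongr
  · exact sdist_nonneg x y
  · exact sdist_le_pi x y

theorem cost_sub_cost_le (x x' y : Sph n) : cost x' y - cost x y ≤ Real.pi * sdist x x' := by
  have h1 := sdist_triangle x' x y
  rw [sdist_comm x' x] at h1
  have h2 := sdist_nonneg x' y
  have h3 := sdist_nonneg x y
  have h4 := sdist_le_pi x' y
  have h5 := sdist_le_pi x y
  have h6 := sdist_nonneg x x'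
  unfold cost
  nlinarith

/-- A finite c-transform is Lipschitz with constant `π`, like all the functions `-c(·, y)`. -/
theorem continuous_cTransform {ψ : Sph n → ℝ}
    (hψ : ∀ x, BddAbove (Set.range fun y => -cost x y - ψ y)) : Continuous (cTransform ψ) := by
  have key : ∀ x x', cTransform ψ x - cTransform ψ x' ≤ Real.pi * sdist x x' := by
    intro x x'
    have : Nonempty (Sph n) := ⟨x⟩
    rw [sub_le_iff_le_add]
    refine ciSup_le fun y => ?_
    have h1 : -cost x' y - ψ y ≤ cTransform ψ x' := le_ciSup (hψ x') y
    have h2 := cost_sub_cost_le x x' y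
    linarith
  refine continuous_iff_continuousAt.mpr fun x => ?_
  rw [ContinuousAt, tendsto_iff_norm_sub_tendsto_zero]
  have h0 : Tendsto (fun z => Real.pi * sdist z x) (𝓝 x) (𝓝 0) := by
    have h1 : Continuous fun z : Sph n => Real.pi * sdist z x :=
      (continuous_sdist.comp (Continuous.prodMk continuous_id continuous_const)).const_mul _
    have h2 := h1.tendsto x
    simpa [sdist] using h2
  refine squeeze_zero (fun _ => norm_nonneg _) (fun z => ?_) h0
  rw [Real.norm_eq_abs, abs_le]
  have h1 := key z x
  have h2 := key x z
  rw [sdist_comm x z] at h2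
  exact ⟨by linarith, h1⟩

theorem IsCConvex.continuous {φ : Sph n → ℝ} (hφ : IsCConvex φ) : Continuous φ := by
  obtain ⟨ψ, hψ, rfl⟩ := hφ
  exact continuous_cTransform hψ

theorem IsCConvex.bddAbove {φ : Sph n → ℝ} (hφ : IsCConvex φ) (y : Sph n) :
    BddAbove (Set.range fun x => -cost y x - φ x) := by
  obtain ⟨ψ, hψ, rfl⟩ := hφ
  refine ⟨Real.pi ^ 2 / 2 + ψ y, ?_⟩
  rintro _ ⟨x, rfl⟩
  have h1 : -cost x y - ψ y ≤ cTransform ψ x := le_ciSup (hψ x) y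
  have h2 := cost_le x y
  have h3 := cost_nonneg y x
  change -cost y x - cTransform ψ x ≤ _
  linarith

theorem IsCConvex.neg_cost_le_add {φ : Sph n → ℝ} (hφ : IsCConvex φ) (x y : Sph n) :
    -cost x y ≤ φ x + cTransform φ y := by
  have : -cost y x - φ x ≤ cTransform φ y := le_ciSup (hφ.bddAbove y) x
  rw [cost_comm y x] at this
  linarith

theorem IsCConvex.mem_contactSet_iff {φ : Sph n → ℝ} (hφ : IsCConvex φ) {x y : Sph n} :
    y ∈ contactSet φ x ↔ ∀ z, cost x y - cost z y ≤ φ z - φ x := by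
  change φ x + cTransform φ y = -cost x y ↔ _
  refine ⟨fun h z => ?_, fun h => le_antisymm ?_ (hφ.neg_cost_le_add x y)⟩
  · have := hφ.neg_cost_le_add z y
    linarith
  · have : Nonempty (Sph n) := ⟨x⟩
    have h1 : cTransform φ y ≤ -cost x y - φ x := ciSup_le fun z => by
      have := h z
      rw [cost_comm y z]
      linarith
    linarith

/-- Since `φ = φ^{cc}` and `φ^c` is continuous, the supremum defining `φ^{cc}(x)` is attained. -/
theorem IsCConvex.contactSet_nonempty {φ : Sph n → ℝ} (hφ : IsCConvex φ) (x : Sph n) :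
    (contactSet φ x).Nonempty := by
  have hc : Continuous fun y => -cost x y - cTransform φ y :=
    ((continuous_cost.comp (Continuous.prodMk continuous_const continuous_id)).neg).sub
      (continuous_cTransform hφ.bddAbove)
  have : Nonempty (Sph n) := ⟨x⟩
  obtain ⟨y, -, hy⟩ := isCompact_univ.exists_isMaxOn Set.univ_nonempty hc.continuousOn
  refine ⟨y, le_antisymm ?_ (hφ.neg_cost_le_add x y)⟩
  obtain ⟨ψ, hψ, hφψ⟩ := id hφ
  suffices φ x ≤ -cost x y - cTransform φ y by linarith
  conv_lhs => rw [hφψ]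
  refine ciSup_le fun y' => ?_
  refine le_trans ?_ (hy (Set.mem_univ y'))
  have : cTransform φ y' ≤ ψ y' := ciSup_le fun z => by
    have h1 : -cost z y' - ψ y' ≤ φ z := by rw [hφψ]; exact le_ciSup (hψ z) y'
    rw [cost_comm y' z]
    linarith
  change -cost x y' - ψ y' ≤ -cost x y' - cTransform φ y'
  linarith

/-! ### Subdifferentials -/

theorem convex_subdiff (f : Sph n → ℝ) (x : Sph n) : Convex ℝ (subdiff f x) := by
  intro p hp q hq s t hs ht hst ε hε
  filter_upwards [hp ε hε, hq ε hε] with v h1 h2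
  rw [inner_add_left, inner_smul_left, inner_smul_left, conj_trivial, conj_trivial]
  have ht1 : t = 1 - s := by linarith
  subst ht1
  nlinarith [mul_le_mul_of_nonneg_left h1 hs, mul_le_mul_of_nonneg_left h2 ht]

theorem IsCConvex.cSubdiff_subset {φ : Sph n → ℝ} (hφ : IsCConvex φ) (x : Sph n) :
    cSubdiff φ x ⊆ subdiff φ x := by
  intro p hp
  simp only [cSubdiff, negGradImage, Set.mem_iUnion] at hp
  obtain ⟨y, hy, hp⟩ := hp
  intro ε hε
  filter_upwards [hp ε hε] with v hv
  have := hφ.mem_contactSet_iff.mp hy (expMap x v)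
  linarith

/-- By the triangle inequality `c(x, y) - c(z, y) ≤ c(x, -x) - c(z, -x)` for all `y` and `z`. -/
theorem IsCConvex.contactSet_eq_univ {φ : Sph n → ℝ} (hφ : IsCConvex φ) {x : Sph n}
    (hx : -x ∈ contactSet φ x) : contactSet φ x = Set.univ := by
  refine Set.eq_univ_of_forall fun y => hφ.mem_contactSet_iff.mpr fun z => ?_
  refine le_trans ?_ (hφ.mem_contactSet_iff.mp hx z)
  have hz : sdist z (-x) = Real.pi - sdist x z := by
    rw [sdist_comm x z]
    simp only [sdist_eq_angle, coe_neg_sphere, InnerProductGeometry.angle_neg_right]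
  have hxx : sdist x (-x) = Real.pi := by
    simp [sdist]
  have h1 := sdist_triangle x z y
  have h2 := sdist_triangle x y z
  rw [sdist_comm y z] at h2
  have h3 := sdist_le_pi x y
  have h4 := sdist_nonneg x z
  have h5 : (sdist x y - sdist x z) ^ 2 ≤ sdist z y ^ 2 := sq_le_sq' (by linarith) (by linarith)
  have h6 : sdist x z * sdist x y ≤ sdist x z * Real.pi := by gcongr
  unfold cost
  rw [hz, hxx]
  linarith

theorem mem_negGradCost_expMap (x : Sph n) {p : Tan x} (hp : ‖p‖ ≤ Real.pi) :
    p ∈ negGradCost x (expMap x p) := by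
  intro ε hε
  have h0 : ∀ᶠ v : Tan x in 𝓝 0, ‖v‖ < ε := by
    simpa using (continuous_norm (E := Tan x)).tendsto 0 |>.eventually_lt_const
      (by simpa using hε)
  filter_upwards [h0] with v hv
  have h1 := sdist_expMap_expMap_le x v p
  have h2 : sdist (expMap x v) (expMap x p) ^ 2 ≤ ‖v - p‖ ^ 2 :=
    pow_le_pow_left₀ (sdist_nonneg _ _) h1 2
  rw [norm_sub_sq_real, real_inner_comm] at h2
  rw [cost_expMap x hp, cost]
  nlinarith [norm_nonneg v]

/-- The tangent vectors `p` in the closed ball of radius `π` for which `y = exp_x(p)` supports `φ`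
at `x`, that is `c(x, y) - c(·, y) ≤ φ - φ(x)`. -/
def supportSet (φ : Sph n → ℝ) (x : Sph n) : Set (Tan x) :=
  {p | ‖p‖ ≤ Real.pi ∧ ∀ z, ‖p‖ ^ 2 / 2 - cost z (expMap x p) ≤ φ z - φ x}

theorem continuous_expMap (x : Sph n) : Continuous (expMap x) := by
  refine Continuous.subtype_mk ?_ _
  exact ((Real.continuous_cos.comp continuous_norm).smul continuous_const).add
    ((Real.continuous_sinc.comp continuous_norm).smul continuous_subtype_val)

theorem supportSet_eq (φ : Sph n → ℝ) (x : Sph n) :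
    supportSet φ x = {p : Tan x | ‖p‖ ≤ Real.pi} ∩
      ⋂ z, {p : Tan x | ‖p‖ ^ 2 / 2 - cost z (expMap x p) ≤ φ z - φ x} := by
  ext p
  simp [supportSet]

theorem isClosed_supportSet (φ : Sph n → ℝ) (x : Sph n) : IsClosed (supportSet φ x) := by
  rw [supportSet_eq]
  have h1 : IsClosed {p : Tan x | ‖p‖ ≤ Real.pi} := isClosed_le continuous_norm continuous_const
  refine h1.inter (isClosed_iInter fun z => ?_)
  have h2 : Continuous fun p : Tan x => cost z (expMap x p) :=
    continuous_iff_continuousAt.mpr fun p =>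
      tendsto_cost tendsto_const_nhds ((continuous_expMap x).tendsto p)
  exact isClosed_le (((continuous_norm.pow 2).div_const 2).sub h2) continuous_const

theorem convex_supportSet (hn : 2 ≤ n) (φ : Sph n → ℝ) (x : Sph n) :
    Convex ℝ (supportSet φ x) := by
  rw [supportSet_eq]
  have h1 : Convex ℝ {p : Tan x | ‖p‖ ≤ Real.pi} := by
    simpa using (convexOn_univ_norm (E := Tan x)).convex_le Real.pi
  have h2 : ∀ z, Convex ℝ {p : Tan x | ‖p‖ ^ 2 / 2 - cost z (expMap x p) ≤ φ z - φ x} := by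
    intro z
    simpa using (convexOn_sq_norm_sub_cost hn x z).convex_le (φ z - φ x)
  exact h1.inter (convex_iInter h2)

theorem IsCConvex.supportSet_subset {φ : Sph n → ℝ} (hφ : IsCConvex φ) (x : Sph n) :
    supportSet φ x ⊆ cSubdiff φ x := by
  rintro p ⟨hp, h⟩
  refine Set.mem_iUnion₂.mpr ⟨expMap x p, hφ.mem_contactSet_iff.mpr fun z => ?_,
    mem_negGradCost_expMap x hp⟩
  rw [cost_expMap x hp]
  exact h z

/-- If `z = exp_x(h v)` and `y = exp_z(q)`, the slope of `-c(·, y)` from `x` to `z` is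
`⟪q, v⟫` up to terms vanishing with `h`: this is the non-expansion of `exp_z`. -/
theorem cost_sub_cost_expMap_le (hn : 2 ≤ n) (x : Sph n) (v : Tan x) {h : ℝ} (h0 : 0 < h)
    (hh : h * ‖v‖ < 1) {z : Sph n} (hz : expMap x (h • v) = z) {q : Tan z} (hq : ‖q‖ ≤ Real.pi) :
    cost x (expMap z q) - cost z (expMap z q) ≤
      h * (inner ℝ (q : EuclideanSpace ℝ (Fin n)) (v : EuclideanSpace ℝ (Fin n)) /
        Real.cos (h * ‖v‖) + h * ‖v‖ ^ 2 / 2) := by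
  have hr : ‖h • v‖ = h * ‖v‖ := by rw [norm_smul, Real.norm_of_nonneg h0.le]
  have hr0 : 0 ≤ h * ‖v‖ := by positivity
  obtain ⟨w, hw, hwn⟩ := exists_expMap_eq hn z x
  have hwn' : ‖w‖ = h * ‖v‖ := by
    rw [hwn, sdist_comm, ← hz, sdist_expMap x (by rw [hr]; linarith [Real.pi_gt_three]), hr]
  have h1 : sdist x (expMap z q) ^ 2 ≤ ‖w - q‖ ^ 2 := by
    have := sdist_expMap_expMap_le z w q
    rw [hw] at this
    exact pow_le_pow_left₀ (sdist_nonneg _ _) this 2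
  rw [norm_sub_sq_real, hwn'] at h1
  have hsinc : 0 < Real.sinc (h * ‖v‖) := by
    rcases hr0.eq_or_lt with h2 | h2
    · rw [← h2]; simp
    · rw [Real.sinc_of_ne_zero h2.ne']
      exact div_pos (Real.sin_pos_of_pos_of_lt_pi h2 (by linarith [Real.pi_gt_three])) h2
  have hcos : 0 < Real.cos (h * ‖v‖) :=
    Real.cos_pos_of_mem_Ioo ⟨by linarith [Real.pi_pos], by linarith [Real.pi_gt_three]⟩
  -- Pairing `q ⊥ z` with the expressions of `x` as `exp_z(w)` and of `z` as `exp_x(h v)`.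
  have e1 : inner ℝ (q : EuclideanSpace ℝ (Fin n)) (x : EuclideanSpace ℝ (Fin n)) =
      Real.sinc (h * ‖v‖) * inner ℝ w q := by
    conv_lhs => rw [← hw]
    simp only [expMap, hwn', inner_add_right, inner_smul_right]
    rw [real_inner_comm, inner_coe_tan z q, mul_zero, zero_add, Submodule.coe_inner,
      real_inner_comm]
  have e2 : Real.cos (h * ‖v‖) *
        inner ℝ (q : EuclideanSpace ℝ (Fin n)) (x : EuclideanSpace ℝ (Fin n)) +
      Real.sinc (h * ‖v‖) * (h * inner ℝ (q : EuclideanSpace ℝ (Fin n)) v) = 0 := by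
    have : inner ℝ (q : EuclideanSpace ℝ (Fin n))
        (expMap x (h • v) : EuclideanSpace ℝ (Fin n)) = (0 : ℝ) := by
      rw [real_inner_comm, hz, inner_coe_tan z q]
    simpa only [expMap, hr, inner_add_right, inner_smul_right, Submodule.coe_smul] using this
  have e3 : -inner ℝ w q =
      h * inner ℝ (q : EuclideanSpace ℝ (Fin n)) v / Real.cos (h * ‖v‖) := by
    rw [eq_div_iff hcos.ne']
    refine mul_left_cancel₀ hsinc.ne' ?_
    rw [e1] at e2
    linarith
  rw [cost_expMap z hq, cost, mul_add, ← mul_div_assoc, ← e3]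
  linarith

theorem tendsto_expMap {ι : Type*} {l : Filter ι} {z : ι → Sph n} {x : Sph n}
    {q : ∀ i, Tan (z i)} {p : Tan x} (hz : Tendsto z l (𝓝 x))
    (hq : Tendsto (fun i => (q i : EuclideanSpace ℝ (Fin n))) l (𝓝 p)) :
    Tendsto (fun i => expMap (z i) (q i)) l (𝓝 (expMap x p)) := by
  rw [tendsto_subtype_rng]
  have hz' : Tendsto (fun i => (z i : EuclideanSpace ℝ (Fin n))) l (𝓝 x) :=
    tendsto_subtype_rng.mp hz
  exact ((Real.continuous_cos.tendsto _).comp hq.norm |>.smul hz').add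
    ((Real.continuous_sinc.tendsto _).comp hq.norm |>.smul hq)

/-- For `p ∈ ∂φ(x)` and a direction `v`, a limit of points of contact of `φ` at `exp_x(h v)`, as
`h` decreases to `0`, is a point of contact at `x` whose tangent vector `q` has
`⟪p, v⟫ ≤ ⟪q, v⟫`. -/
theorem IsCConvex.exists_mem_supportSet_inner_le (hn : 2 ≤ n) {φ : Sph n → ℝ} (hφ : IsCConvex φ)
    {x : Sph n} {p : Tan x} (hp : p ∈ subdiff φ x) (v : Tan x) :
    ∃ q ∈ supportSet φ x, (inner ℝ p v : ℝ) ≤ inner ℝ q v := by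
  set z : ℝ → Sph n := fun h => expMap x (h • v) with hz
  have hex : ∀ h, ∃ q : Tan (z h), ‖q‖ ≤ Real.pi ∧ expMap (z h) q ∈ contactSet φ (z h) := by
    intro h
    obtain ⟨y, hy⟩ := hφ.contactSet_nonempty (z h)
    obtain ⟨q, rfl, hq⟩ := exists_expMap_eq hn (z h) y
    exact ⟨q, hq.trans_le (sdist_le_pi _ _), hy⟩
  choose q hqπ hqc using hex
  set h : ℕ → ℝ := fun k => 1 / ((k : ℝ) + 1) with hh
  have hh0 : Tendsto h atTop (𝓝 0) := tendsto_one_div_add_atTop_nhds_zero_nat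
  have hhpos : ∀ k, 0 < h k := fun k => by positivity
  obtain ⟨q₀, hq₀, σ, hσ, hlim⟩ := (isCompact_closedBall (0 : EuclideanSpace ℝ (Fin n))
    Real.pi).tendsto_subseq (x := fun k => (q (h k) : EuclideanSpace ℝ (Fin n)))
    (fun k => by simpa using hqπ (h k))
  have hhσ : Tendsto (h ∘ σ) atTop (𝓝 0) := hh0.comp hσ.tendsto_atTop
  have hhv : Tendsto (fun k => h (σ k) • v) atTop (𝓝 0) := by
    simpa using hhσ.smul_const v
  have hzlim : Tendsto (fun k => z (h (σ k))) atTop (𝓝 x) := by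
    have := ((continuous_expMap x).tendsto 0).comp hhv
    rwa [expMap_zero] at this
  have hzlim' : Tendsto (fun k => (z (h (σ k)) : EuclideanSpace ℝ (Fin n))) atTop (𝓝 x) :=
    tendsto_subtype_rng.mp hzlim
  have horth : inner ℝ (x : EuclideanSpace ℝ (Fin n)) q₀ = (0 : ℝ) := by
    refine tendsto_nhds_unique (hzlim'.inner hlim) ?_
    simp only [Function.comp_def, inner_coe_tan, tendsto_const_nhds]
  obtain ⟨q', rfl⟩ : ∃ q' : Tan x, (q' : EuclideanSpace ℝ (Fin n)) = q₀ :=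
    ⟨⟨q₀, Submodule.mem_orthogonal_singleton_iff_inner_right.mpr horth⟩, rfl⟩
  have hylim : Tendsto (fun k => expMap (z (h (σ k))) (q (h (σ k)))) atTop (𝓝 (expMap x q')) :=
    tendsto_expMap hzlim hlim
  have hnlim : Tendsto (fun k => ‖q (h (σ k))‖) atTop (𝓝 ‖q'‖) := hlim.norm
  have hφlim : Tendsto (fun k => φ (z (h (σ k)))) atTop (𝓝 (φ x)) :=
    (hφ.continuous.tendsto x).comp hzlim
  refine ⟨q', ⟨by simpa using hq₀, fun y => ?_⟩, ?_⟩
  · have hclim : Tendsto (fun k => cost y (expMap (z (h (σ k))) (q (h (σ k))))) atTop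
        (𝓝 (cost y (expMap x q'))) :=
      tendsto_cost tendsto_const_nhds hylim
    refine le_of_tendsto_of_tendsto' (((hnlim.pow 2).div_const 2).sub hclim)
      (tendsto_const_nhds.sub hφlim) fun k => ?_
    have := hφ.mem_contactSet_iff.mp (hqc (h (σ k))) y
    rwa [cost_expMap _ (hqπ _)] at this
  · refine le_of_forall_pos_le_add fun ε hε => ?_
    have hε' : 0 < ε / (‖v‖ + 1) := by positivity
    have hlhs : (inner ℝ p v : ℝ) - ε ≤ inner ℝ q' v := by
      have hhn : Tendsto (fun k => h (σ k) * ‖v‖) atTop (𝓝 0) := by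
        simpa using hhσ.mul_const ‖v‖
      have hcos : Tendsto (fun k => Real.cos (h (σ k) * ‖v‖)) atTop (𝓝 1) := by
        have := (Real.continuous_cos.tendsto 0).comp hhn
        rwa [Real.cos_zero] at this
      have hin : Tendsto (fun k => inner ℝ (q (h (σ k)) : EuclideanSpace ℝ (Fin n))
          (v : EuclideanSpace ℝ (Fin n))) atTop (𝓝 (inner ℝ q' v)) :=
        hlim.inner tendsto_const_nhds
      have hrhs : Tendsto (fun k => inner ℝ (q (h (σ k)) : EuclideanSpace ℝ (Fin n))
          (v : EuclideanSpace ℝ (Fin n)) / Real.cos (h (σ k) * ‖v‖) + h (σ k) * ‖v‖ ^ 2 / 2)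
          atTop (𝓝 (inner ℝ q' v)) := by
        simpa using (hin.div hcos one_ne_zero).add ((hhσ.mul_const (‖v‖ ^ 2)).div_const 2)
      refine ge_of_tendsto hrhs ?_
      filter_upwards [hhv.eventually (hp _ hε'), hhn.eventually_lt_const one_pos] with k h1 h2
      have h3 := cost_sub_cost_expMap_le hn x v (hhpos (σ k)) h2 rfl (hqπ (h (σ k)))
      have h4 := hφ.mem_contactSet_iff.mp (hqc (h (σ k))) x
      refine le_of_mul_le_mul_left (le_trans ?_ h3) (hhpos (σ k))
      rw [inner_smul_right, norm_smul, Real.norm_of_nonneg (hhpos _).le] at h1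
      have h5 : ε / (‖v‖ + 1) * (h (σ k) * ‖v‖) ≤ h (σ k) * ε := by
        rw [mul_left_comm]
        refine mul_le_mul_of_nonneg_left ?_ (hhpos _).le
        rw [div_mul_eq_mul_div, div_le_iff₀ (by positivity)]
        nlinarith [norm_nonneg v]
      change _ ≤ φ (z (h (σ k))) at h1
      linarith
    linarith

/-- The closed convex set `supportSet φ x` meets every half space that contains an element of the
subdifferential, so it contains the subdifferential. -/
theorem IsCConvex.subdiff_subset_supportSet (hn : 2 ≤ n) {φ : Sph n → ℝ} (hφ : IsCConvex φ)
    (x : Sph n) : subdiff φ x ⊆ supportSet φ x := by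
  intro p hp
  by_contra hpS
  obtain ⟨f, u, hfu, hup⟩ :=
    geometric_hahn_banach_closed_point (convex_supportSet hn φ x) (isClosed_supportSet φ x) hpS
  set v := (InnerProductSpace.toDual ℝ (Tan x)).symm f with hv
  have hfv : ∀ a, f a = inner ℝ a v := fun a => by
    rw [real_inner_comm, hv, InnerProductSpace.toDual_symm_apply]
  obtain ⟨q, hq, hle⟩ := hφ.exists_mem_supportSet_inner_le hn hp v
  have := hfu q hq
  rw [hfv] at this hup
  linarith

end SphereOT

end

theorem theorem2p3 (n : ℕ) (hn : 2 ≤ n) (φ : SphereOT.Sph n → ℝ) (hφ : SphereOT.IsCConvex φ)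
    (x : SphereOT.Sph n) :
    (SphereOT.IsCConvexSet x (SphereOT.contactSet φ x) ∧
      SphereOT.subdiff φ x = SphereOT.cSubdiff φ x) ∧
    (-x ∈ SphereOT.contactSet φ x → SphereOT.contactSet φ x = Set.univ) := by
  have heq : SphereOT.subdiff φ x = SphereOT.cSubdiff φ x :=
    ((hφ.subdiff_subset_supportSet hn x).trans (hφ.supportSet_subset x)).antisymm
      (hφ.cSubdiff_subset x)
  refine ⟨⟨?_, heq⟩, fun h => hφ.contactSet_eq_univ h⟩
  have h : Convex ℝ (SphereOT.cSubdiff φ x) := heq ▸ SphereOT.convex_subdiff φ x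
  exact h
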